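/- Let $X$ be an integral regular projective curve over a finite field $\mathbb F_q$ with function field $F$. For a closed point $p$ let $\mathcal O_{X,p}\subset F$ be its local ring, $F_p$ the completion of $F$ at $p$, $\mathcal O_p\subset F_p$ its ring of integers, and fix a local parameter $\pi_p\in F$ at $p$. Let $\mathbb A$ be the adele ring of $F$ (the restricted product of the $F_p$ with respect to the $\mathcal O_p$), with $F\subset\mathbb A$ diagonally, and $\mathcal O=\prod_p\mathcal O_p\subset\mathbb A$. For a divisor $E$ put $\iota_E=(\pi_p^{\mathrm{ord}_p(E)})_p\in\mathbb A^\times$. Let $r\ge 1$ and let $D=p_1+\dots+p_n$ with distinct $\mathbb F_q$-rational points $p_i$. An element $g\in\mathrm{GL}_r(\mathbb A)$ is called $D$-balanced if for every $i$ its $p_i$-multiple orders are $(0,\dots,0)$, where the $p$-multiple orders $m_1\le\dots\le m_r$ of $g$ are the integers with $M g_p N=\mathrm{diag}(\pi_p^{m_1},\dots,\pi_p^{m_r})$ for some $M,N\in\mathrm{GL}_r(\mathcal O_p)$. Let $\Omega_F$ be the space of rational differentials of $F/\mathbb F_q$; for $\omega\in\Omega_F$ and a rational point $p$ let $\omega_p(a)=\mathrm{res}_p(a\omega)$.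 A non-zero $\omega_0\in\Omega_F$ is called $D$-special if $\mathrm{ord}_{p_i}(\omega_0)=-1$ and $\mathrm{res}_{p_i}(\omega_0)=1$ for all $i$. Write $(\omega_0)$ for its divisor. For $h\in\mathrm{GL}_r(\mathbb A)$ put $H^0(F,h)=\{f\in F^r: hf\in\mathcal O^r\}$ and, for $D$-balanced $h$, $$C_{F,r}(D,h)=\{((f_j(p_1))_j,\dots,(f_j(p_n))_j)\in(\mathbb F_q^{r})^n : (f_j)\in H^0(F,h)\}.$$ For $D$-balanced $g$ and a $D$-special $\omega_0$ put $$\Omega^r_F(g(-D))=\{(\omega_j)\in\Omega_F^r:\ \iota_{(\omega_0)+D}\,(\omega_j/\omega_0)_j\in g\,\mathcal O^r\},$$ $$C_{\Omega,r}(D,g)=\{((\omega_{j,p_1}(1))_j,\dots,(\omega_{j,p_n}(1))_j) : (\omega_j)\in\Omega^r_F(g(-D))\}.$$ Then for every $D$-balanced $g\in\mathrm{GL}_r(\mathbb A)$ and every $D$-special rational differential $\omega_0$, the element $\iota_{(\omega_0)+D}\,g^{-1}$ is $D$-balanced and $$C_{\Omega,r}(D,g)=C_{F,r}\bigl(D,\iota_{(\omega_0)+D}\,g^{-1}\bigr).$$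 -/

import Mathlib

open Polynomial IsDedekindDomain IntermediateField
open scoped WithZero KaehlerDifferential

namespace AdelicCode

/-- `F / k` is the function field of an integral curve over `k`: a finitely generated field
extension of transcendence degree one. -/
class IsFunctionField (k F : Type*) [Field k] [Field F] [Algebra k F] : Prop where
  essFiniteType : Algebra.EssFiniteType k F
  trdeg_eq_one : Algebra.trdeg k F = 1

/-- The closed points of the regular projective curve with function field `F / k`, given by their
local rings: the discrete valuation rings of `F` that contain `k` and have fraction field `F`. -/
@[ext]
structure Place (k F : Type*) [Field k] [Field F] [Algebra k F] where
  /-- the local ring of the curve at the point -/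
  ring : ValuationSubring F
  isDVR : IsDiscreteValuationRing ring
  algebraMap_mem : ∀ c : k, algebraMap k F c ∈ ring

section Places

variable {k F : Type*} [Field k] [Field F] [Algebra k F]

namespace Place

instance (p : Place k F) : IsDiscreteValuationRing p.ring := p.isDVR

instance (p : Place k F) : Algebra k p.ring :=
  ((algebraMap k F).codRestrict p.ring.toSubring p.algebraMap_mem).toAlgebra

instance (p : Place k F) : IsScalarTower k p.ring F := .of_algebraMap_eq fun _ => rfl

/-- The maximal ideal of the local ring at `p`. -/
noncomputable abbrev spec (p : Place k F) : HeightOneSpectrum p.ring :=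
  IsDiscreteValuationRing.maximalIdeal p.ring

/-- The normalized (multiplicative) valuation of `F` at `p`. -/
noncomputable abbrev valuation (p : Place k F) : Valuation F ℤᵐ⁰ := p.spec.valuation F

/-- The order `ord_p f` of a non-zero `f : F` at `p`. -/
noncomputable def ord (p : Place k F) (f : F) : ℤ := -WithZero.log (p.valuation f)

/-- The degree of `p`, that is, the degree of its residue field over `k`. -/
noncomputable def degree (p : Place k F) : ℕ :=
  Module.finrank k (IsLocalRing.ResidueField p.ring)

open Classical in
/-- The value `f(p)` in `k` of a function `f` that is regular at a point `p` of degree one (where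
the residue field is `k`). -/
noncomputable def value (p : Place k F) (f : F) : k :=
  if h : f ∈ p.ring then
    Function.invFun (algebraMap k (IsLocalRing.ResidueField p.ring))
      (IsLocalRing.residue p.ring ⟨f, h⟩)
  else 0

/-- The local field `F_p`, the completion of `F` at `p`. -/
noncomputable abbrev Completion (p : Place k F) : Type _ := p.spec.adicCompletion F

/-- The ring of integers `O_p` of the local field `F_p`. -/
noncomputable abbrev integers (p : Place k F) : ValuationSubring p.Completion :=
  p.spec.adicCompletionIntegers F

theorem valuation_le_one_iff (p : Place k F) (f : F) : p.valuation f ≤ 1 ↔ f ∈ p.ring := by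
  constructor
  · intro h
    obtain ⟨a, rfl⟩ := IsDiscreteValuationRing.exists_lift_of_le_one h
    exact a.2
  · intro h
    exact p.spec.valuation_le_one (K := F) ⟨f, h⟩

theorem exists_heightOneSpectrum {B : Type*} [CommRing B] [IsDedekindDomain B] [Algebra B F]
    [IsFractionRing B F] (p : Place k F) (hB : ∀ b : B, algebraMap B F b ∈ p.ring) :
    ∃ q : HeightOneSpectrum B, p.ring = (q.valuation F).valuationSubring ∧
      ∀ b : B, b ∈ q.asIdeal ↔ p.valuation (algebraMap B F b) < 1 := by
  let φ : B →+* p.ring := (algebraMap B F).codRestrict p.ring.toSubring hB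
  let I : Ideal B := (IsLocalRing.maximalIdeal p.ring).comap φ
  have hI : ∀ b : B, b ∈ I ↔ p.valuation (algebraMap B F b) < 1 := by
    intro b
    have := (p.spec.valuation_lt_one_iff_mem (K := F) (φ b))
    exact this.symm
  have hne : I ≠ ⊥ := by
    intro hbot
    have htop : ∀ f : F, f ∈ p.ring := by
      intro f
      obtain ⟨a, s, hs, rfl⟩ := IsFractionRing.div_surjective (A := B) f
      rw [← valuation_le_one_iff, map_div₀]
      have h1 : ¬ p.valuation (algebraMap B F s) < 1 := by
        rw [← hI, hbot, Ideal.mem_bot]; exact nonZeroDivisors.ne_zero hs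
      have h2 := (p.valuation_le_one_iff _).2 (hB a)
      have h3 := (p.valuation_le_one_iff _).2 (hB s)
      have h4 : p.valuation (algebraMap B F s) = 1 := le_antisymm h3 (not_lt.1 h1)
      simpa [h4] using h2
    obtain ⟨t, ht⟩ := p.spec.valuation_exists_uniformizer F
    have := (p.valuation_le_one_iff _).2 (htop t⁻¹)
    rw [map_inv₀, ht, ← WithZero.exp_neg] at this
    simp [← WithZero.exp_zero] at this
  let q : HeightOneSpectrum B := ⟨I, Ideal.IsPrime.comap φ, hne⟩
  refine ⟨q, ?_, hI⟩
  symm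
  rw [← HeightOneSpectrum.valuationSubringAtPrime_eq_valuationSubring]
  apply ValuationSubring.eq_of_le_of_ne_top
  · rintro x ⟨a, s, hs, rfl⟩
    have h1 : ¬ p.valuation (algebraMap B F s) < 1 := by
      rw [← hI]; exact hs
    have h3 := (p.valuation_le_one_iff _).2 (hB s)
    have h4 : p.valuation (algebraMap B F s) = 1 := le_antisymm h3 (not_lt.1 h1)
    have h2 := (p.valuation_le_one_iff _).2 (hB a)
    change _ ∈ p.ring
    rw [← valuation_le_one_iff]
    simpa [h4] using h2
  · intro htop
    obtain ⟨t, ht⟩ := p.spec.valuation_exists_uniformizer F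
    have := (p.valuation_le_one_iff t⁻¹).2 (by rw [htop]; trivial)
    rw [map_inv₀, ht, ← WithZero.exp_neg] at this
    simp [← WithZero.exp_zero] at this

theorem finite_of_dedekind {B : Type*} [CommRing B] [IsDedekindDomain B] [Algebra B F]
    [IsFractionRing B F] (f : F) :
    {p : Place k F | (∀ b : B, algebraMap B F b ∈ p.ring) ∧ f ∉ p.ring}.Finite := by
  refine Set.Finite.of_finite_image (f := Place.ring) ?_ (fun p _ q _ h => Place.ext h)
  refine ((HeightOneSpectrum.Support.finite B f).image
    (fun q => (q.valuation F).valuationSubring)).subset ?_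
  rintro _ ⟨p, ⟨hp, hf⟩, rfl⟩
  obtain ⟨q, hq, -⟩ := p.exists_heightOneSpectrum hp
  refine ⟨q, ?_, hq.symm⟩
  rw [hq] at hf
  exact not_le.1 fun h => hf ((Valuation.mem_valuationSubring_iff _ _).2 h)

end Place

theorem exists_separating [PerfectField k] [h : IsFunctionField k F] :
    ∃ x : F, Transcendental k x ∧ Algebra.IsSeparable k⟮x⟯ F ∧ FiniteDimensional k⟮x⟯ F := by
  have := h.essFiniteType
  obtain ⟨s, hs, hsep⟩ :=
    exists_isTranscendenceBasis_and_isSeparable_of_perfectField k F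
  have h1 := hs.cardinalMk_eq_trdeg
  rw [h.trdeg_eq_one] at h1
  have h2 : s.card = 1 := by simpa using h1
  obtain ⟨x, rfl⟩ := Finset.card_eq_one.1 h2
  have hx : Transcendental k x := by
    have := hs.1.transcendental ⟨x, by simp⟩
    simpa using this
  rw [Finset.coe_singleton] at hsep
  refine ⟨x, hx, hsep, ?_⟩
  have : Algebra.EssFiniteType k⟮x⟯ F := Algebra.EssFiniteType.of_comp k k⟮x⟯ F
  exact Algebra.finite_of_essFiniteType_of_isAlgebraic

theorem finite_aux (x : F) (hx : Transcendental k x) [Algebra.IsSeparable k⟮x⟯ F]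
    [FiniteDimensional k⟮x⟯ F] :
   let B := integralClosure (Algebra.adjoin k {x}) F
   IsDedekindDomain B ∧ IsFractionRing B F ∧ Module.Finite (Algebra.adjoin k {x}) B := by
  intro B
  open scoped IntermediateField.algebraAdjoinAdjoin in
  have e : k[X] ≃ₐ[k] Algebra.adjoin k {x} := Polynomial.algEquivOfTranscendental k x hx
  have : IsPrincipalIdealRing (Algebra.adjoin k {x}) :=
    IsPrincipalIdealRing.of_surjective e.toRingHom e.surjective
  have : IsScalarTower (Algebra.adjoin k {x}) k⟮x⟯ F := inferInstance
  have h1 := integralClosure.isDedekindDomain (Algebra.adjoin k {x}) k⟮x⟯ F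
  have h2 := integralClosure.isFractionRing_of_finite_extension (A := Algebra.adjoin k {x}) k⟮x⟯ F
  have h3 := IsIntegralClosure.finite (Algebra.adjoin k {x}) k⟮x⟯ F B
  exact ⟨h1, h2, h3⟩


theorem integralClosure_mem (p : Place k F) {x : F} (hxp : x ∈ p.ring) {b : F}
    (hb : b ∈ integralClosure (Algebra.adjoin k {x}) F) : b ∈ p.ring := by
  have hle : ∀ a ∈ Algebra.adjoin k {x}, a ∈ p.ring := by
    intro a ha
    induction ha using Algebra.adjoin_induction with
    | mem y hy => rw [Set.mem_singleton_iff] at hy; exact hy ▸ hxp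
    | algebraMap c => exact p.algebraMap_mem c
    | add y z _ _ hy hz => exact add_mem hy hz
    | mul y z _ _ hy hz => exact mul_mem hy hz
  obtain ⟨Q, hQ, hQ0⟩ := hb
  let φ : Algebra.adjoin k {x} →+* p.ring :=
    (algebraMap (Algebra.adjoin k {x}) F).codRestrict p.ring.toSubring (fun a => hle a a.2)
  have hint : IsIntegral p.ring b := by
    refine ⟨Q.map φ, hQ.map φ, ?_⟩
    rw [eval₂_map]
    exact hQ0
  obtain ⟨y, hy⟩ := IsIntegrallyClosed.isIntegral_iff.1 hint
  exact hy ▸ y.2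

theorem finite_chart (x : F) (hx : Transcendental k x) [Algebra.IsSeparable k⟮x⟯ F]
    [FiniteDimensional k⟮x⟯ F] (f : F) :
    {p : Place k F | x ∈ p.ring ∧ f ∉ p.ring}.Finite := by
  obtain ⟨h1, h2, -⟩ := finite_aux x hx
  refine (Place.finite_of_dedekind (k := k)
    (B := integralClosure (Algebra.adjoin k {x}) F) f).subset ?_
  rintro p ⟨hxp, hf⟩
  exact ⟨fun b => integralClosure_mem p hxp b.2, hf⟩

theorem finite_poles [PerfectField k] [IsFunctionField k F] (f : F) :
    {p : Place k F | f ∉ p.ring}.Finite := by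
  obtain ⟨x, hx, hsep, hfin⟩ := exists_separating (k := k) (F := F)
  have hadj : k⟮x⁻¹⟯ = k⟮x⟯ := by
    apply le_antisymm
    · rw [adjoin_simple_le_iff]
      exact inv_mem (mem_adjoin_simple_self k x)
    · rw [adjoin_simple_le_iff]
      simpa using inv_mem (mem_adjoin_simple_self k x⁻¹)
  have hx' : Transcendental k x⁻¹ := fun h => hx (by simpa using h.inv)
  have hsep' : Algebra.IsSeparable k⟮x⁻¹⟯ F := by rw [hadj]; exact hsep
  have hfin' : FiniteDimensional k⟮x⁻¹⟯ F := by rw [hadj]; exact hfin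
  refine ((finite_chart (k := k) x hx f).union (finite_chart (k := k) x⁻¹ hx' f)).subset ?_
  intro p hp
  rcases p.ring.mem_or_inv_mem x with h | h
  · exact Or.inl ⟨h, hp⟩
  · exact Or.inr ⟨h, hp⟩

theorem exists_smul_D (x : F) [Algebra.IsSeparable k⟮x⟯ F] (ω : Ω[F⁄k]) :
    ∃ h : F, ω = h • KaehlerDifferential.D k F x := by
  let M : Submodule F (Ω[F⁄k]) := Submodule.span F {KaehlerDifferential.D k F x}
  let d : Derivation k F (Ω[F⁄k] ⧸ M) := M.mkQ.compDer (KaehlerDifferential.D k F)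
  have hd : ∀ y ∈ k⟮x⟯, d y = 0 := by
    intro y hy
    induction hy using adjoin_induction with
    | mem y hy =>
      rw [Set.mem_singleton_iff] at hy
      subst hy
      exact (Submodule.Quotient.mk_eq_zero M).2 (Submodule.mem_span_singleton_self _)
    | algebraMap c => exact d.map_algebraMap c
    | add y z _ _ hy hz => rw [map_add, hy, hz, add_zero]
    | mul y z _ _ hy hz => rw [d.leibniz, hy, hz]; simp
    | inv y _ hy => rw [d.leibniz_inv, hy, smul_zero]
  let d' : Derivation k⟮x⟯ F (Ω[F⁄k] ⧸ M) :=
    { toFun := d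
      map_add' := d.map_add
      map_smul' := fun a y => by
        change d (a • y) = a • d y
        rw [Algebra.smul_def, d.leibniz, IntermediateField.algebraMap_apply, hd _ a.2, smul_zero,
          add_zero]
        rfl
      map_one_eq_zero' := d.map_one_eq_zero
      leibniz' := d.leibniz }
  have hunr := Algebra.FormallyUnramified.of_isSeparable k⟮x⟯ F
  have hz : ∀ y, d y = 0 := by
    intro y
    have h1 : d' y = d'.liftKaehlerDifferential (KaehlerDifferential.D k⟮x⟯ F y) := by simp
    rw [Subsingleton.elim (KaehlerDifferential.D k⟮x⟯ F y) 0, map_zero] at h1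
    exact h1
  have htop : M = ⊤ := by
    rw [eq_top_iff, ← KaehlerDifferential.span_range_derivation, Submodule.span_le]
    rintro _ ⟨y, rfl⟩
    exact (Submodule.Quotient.mk_eq_zero M).1 (hz y)
  have : ω ∈ M := htop ▸ Submodule.mem_top
  obtain ⟨h, hh⟩ := Submodule.mem_span_singleton.1 this
  exact ⟨h, hh.symm⟩

theorem exists_separable_valuation_lt_one [PerfectField k] (p : Place k F) {x : F}
    (hxp : x ∈ p.ring) [Algebra.IsSeparable k⟮x⟯ F] :
    ∃ P : k[X], p.valuation (aeval x P) < 1 ∧ p.valuation (aeval x (derivative P)) = 1 := by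
  have key : ∀ P : k[X], p.valuation (aeval x P) < 1 ↔
      aeval (IsLocalRing.residue p.ring ⟨x, hxp⟩) P = 0 := by
    intro P
    have h1 : aeval x P = algebraMap p.ring F (aeval (⟨x, hxp⟩ : p.ring) P) := by
      rw [← aeval_algebraMap_apply]; rfl
    have h2 : aeval (IsLocalRing.residue p.ring ⟨x, hxp⟩) P =
        IsLocalRing.residue p.ring (aeval (⟨x, hxp⟩ : p.ring) P) := by
      have := aeval_algebraMap_apply (IsLocalRing.ResidueField p.ring) (⟨x, hxp⟩ : p.ring) P
      exact this
    rw [h1, h2, IsLocalRing.residue_eq_zero_iff]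
    exact p.spec.valuation_lt_one_iff_mem (K := F) _
  have hle : ∀ P : k[X], p.valuation (aeval x P) ≤ 1 := by
    intro P
    have h1 : aeval x P = algebraMap p.ring F (aeval (⟨x, hxp⟩ : p.ring) P) := by
      rw [← aeval_algebraMap_apply]; rfl
    rw [h1]
    exact p.spec.valuation_le_one _
  have halg : IsAlgebraic k (IsLocalRing.residue p.ring ⟨x, hxp⟩) := by
    by_contra htr
    have hsub : ∀ y ∈ k⟮x⟯, y ∈ p.ring := by
      intro y hy
      obtain ⟨r, s, rfl⟩ := mem_adjoin_simple_iff k y |>.1 hy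
      rcases eq_or_ne s 0 with rfl | hs
      · simp [zero_mem]
      have h1 : ¬ p.valuation (aeval x s) < 1 := fun h => htr ⟨s, hs, (key s).1 h⟩
      have h2 := le_antisymm (hle s) (not_lt.1 h1)
      rw [← p.valuation_le_one_iff, map_div₀, h2, div_one]
      exact hle r
    have htop : ∀ f : F, f ∈ p.ring := by
      intro f
      obtain ⟨Q, hQ, hQ0⟩ := Algebra.IsIntegral.isIntegral (R := k⟮x⟯) f
      let φ : k⟮x⟯ →+* p.ring :=
        (algebraMap k⟮x⟯ F).codRestrict p.ring.toSubring (fun a => hsub a a.2)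
      have hint : IsIntegral p.ring f := by
        refine ⟨Q.map φ, hQ.map φ, ?_⟩
        rw [eval₂_map]
        exact hQ0
      obtain ⟨y, hy⟩ := IsIntegrallyClosed.isIntegral_iff.1 hint
      exact hy ▸ y.2
    obtain ⟨t, ht⟩ := p.spec.valuation_exists_uniformizer F
    have := (p.valuation_le_one_iff t⁻¹).2 (htop _)
    rw [map_inv₀, ht, ← WithZero.exp_neg] at this
    simp [← WithZero.exp_zero] at this
  let P := minpoly k (IsLocalRing.residue p.ring ⟨x, hxp⟩)
  have hP0 : aeval (IsLocalRing.residue p.ring ⟨x, hxp⟩) P = 0 := minpoly.aeval _ _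
  have hsep : P.Separable :=
    PerfectField.separable_of_irreducible (minpoly.irreducible halg.isIntegral)
  refine ⟨P, (key P).2 hP0, le_antisymm (hle _) (not_lt.1 fun h => ?_)⟩
  rw [key] at h
  obtain ⟨a, b, hab⟩ := hsep
  have := congrArg (aeval (IsLocalRing.residue p.ring ⟨x, hxp⟩)) hab
  simp [hP0, h] at this

theorem uniformizer_differential [PerfectField k] (p : Place k F) {x : F}
    (hxp : x ∈ p.ring) [Algebra.IsSeparable k⟮x⟯ F] (hx0 : KaehlerDifferential.D k F x ≠ 0)
    (hgood : ∀ y ∈ p.ring, ∃ u ∈ p.ring,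
      KaehlerDifferential.D k F y = u • KaehlerDifferential.D k F x)
    {t : F} (ht : p.valuation t = WithZero.exp (-1)) :
    ∃ u : F, p.valuation u = 1 ∧ KaehlerDifferential.D k F t = u • KaehlerDifferential.D k F x := by
  obtain ⟨P, hP, hP'⟩ := exists_separable_valuation_lt_one p hxp
  have ht0 : t ≠ 0 := by rintro rfl; rw [map_zero] at ht; exact WithZero.exp_ne_zero ht.symm
  have htlt : p.valuation t < 1 := by rw [ht, ← WithZero.exp_zero, WithZero.exp_lt_exp]; norm_num
  obtain ⟨u, hu, hdu⟩ := hgood t ((p.valuation_le_one_iff t).1 htlt.le)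
  have hz : aeval x P / t ∈ p.ring := by
    rw [← p.valuation_le_one_iff, map_div₀, ht]
    apply div_le_one_of_le₀ _ zero_le
    rcases eq_or_ne (p.valuation (aeval x P)) 0 with h | h
    · rw [h]; exact zero_le
    · have h3 : WithZero.log (p.valuation (aeval x P)) < 0 :=
        (WithZero.log_lt_iff_lt_exp h).2 (by simpa using hP)
      exact (WithZero.log_le_iff_le_exp h).1 (by omega)
  obtain ⟨z', hz', hdz⟩ := hgood _ hz
  refine ⟨u, ?_, hdu⟩
  have hmul : aeval x P = t * (aeval x P / t) := by field_simp
  have h1 : KaehlerDifferential.D k F (aeval x P) =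
      aeval x (derivative P) • KaehlerDifferential.D k F x := Derivation.map_aeval _ _ _
  rw [hmul, Derivation.leibniz, hdz, hdu, smul_smul, smul_smul, ← add_smul] at h1
  have h2 := smul_left_injective F hx0 h1
  set z := aeval x P / t with hzdef
  have hv1 : p.valuation (t * z') < 1 := by
    rw [map_mul]
    exact (mul_le_of_le_one_right' ((p.valuation_le_one_iff _).2 hz')).trans_lt htlt
  have hv2 : p.valuation (z * u) = 1 := by
    have : z * u = aeval x (derivative P) - t * z' := by rw [← h2]; ring
    rw [this, Valuation.map_sub_eq_of_lt_left _ (by rw [hP']; exact hv1), hP']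
  rw [map_mul] at hv2
  have a1 := (p.valuation_le_one_iff _).2 hz
  have a2 := (p.valuation_le_one_iff _).2 hu
  refine le_antisymm a2 ?_
  rw [← hv2]
  exact mul_le_of_le_one_left' a1

theorem finite_differential_support [PerfectField k] [IsFunctionField k F]
    (t : Place k F → F) (ht : ∀ p : Place k F, p.valuation (t p) = WithZero.exp (-1))
    (ω : Ω[F⁄k]) (hω : ω ≠ 0) :
    {p : Place k F | ¬ ∃ f : F, p.valuation f = 1 ∧
      ω = f • KaehlerDifferential.D k F (t p)}.Finite := by
  obtain ⟨x, hx, hsep, hfin⟩ := exists_separating (k := k) (F := F)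
  obtain ⟨h, rfl⟩ := exists_smul_D (k := k) x ω
  have hx0 : KaehlerDifferential.D k F x ≠ 0 := by rintro h0; simp [h0] at hω
  have hh0 : h ≠ 0 := by rintro rfl; simp at hω
  obtain ⟨hded, hfrac, ⟨S, hS⟩⟩ := finite_aux x hx
  choose c hc using fun y : F => exists_smul_D x (KaehlerDifferential.D k F y)
  have hfinS : (⋃ b ∈ S, {p : Place k F | c b ∉ p.ring}).Finite :=
    S.finite_toSet.biUnion fun b _ => finite_poles _
  refine ((((finite_poles (k := k) x).union (finite_poles h)).union
    (finite_poles h⁻¹)).union hfinS).subset ?_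
  intro p hp
  by_contra hcon
  apply hp
  simp only [Set.mem_union, Set.mem_ofPred_eq, Set.mem_iUnion, not_or, not_not, not_exists] at hcon
  obtain ⟨⟨⟨hxp, hhp⟩, hhp'⟩, hcS⟩ := hcon
  let T : Subalgebra k F :=
    { carrier := {y | y ∈ p.ring ∧ ∃ u ∈ p.ring,
        KaehlerDifferential.D k F y = u • KaehlerDifferential.D k F x}
      mul_mem' := by
        rintro a b ⟨ha, u, hu, hau⟩ ⟨hb, v, hv, hbv⟩
        refine ⟨mul_mem ha hb, a * v + b * u, add_mem (mul_mem ha hv) (mul_mem hb hu), ?_⟩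
        rw [Derivation.leibniz, hau, hbv, smul_smul, smul_smul, add_smul]
      add_mem' := by
        rintro a b ⟨ha, u, hu, hau⟩ ⟨hb, v, hv, hbv⟩
        exact ⟨add_mem ha hb, u + v, add_mem hu hv, by rw [map_add, hau, hbv, add_smul]⟩
      algebraMap_mem' := fun a => ⟨p.algebraMap_mem a, 0, zero_mem _, by simp⟩ }
  have hAT : ∀ a ∈ Algebra.adjoin k {x}, a ∈ T := by
    have : Algebra.adjoin k {x} ≤ T := Algebra.adjoin_le (by
      rintro _ rfl
      exact ⟨hxp, 1, one_mem _, by simp⟩)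
    exact this
  have hBT : ∀ b : integralClosure (Algebra.adjoin k {x}) F, (b : F) ∈ T := by
    intro b
    have hb : b ∈ Submodule.span (Algebra.adjoin k {x}) (S : Set _) := hS ▸ Submodule.mem_top
    induction hb using Submodule.span_induction with
    | mem b hb =>
      exact ⟨integralClosure_mem p hxp b.2, c b, hcS b hb, hc b⟩
    | zero => exact T.zero_mem
    | add a b _ _ ha hb => exact T.add_mem ha hb
    | smul a b _ hb => exact T.mul_mem (hAT a a.2) hb
  have hgood : ∀ y ∈ p.ring, ∃ u ∈ p.ring,
      KaehlerDifferential.D k F y = u • KaehlerDifferential.D k F x := by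
    obtain ⟨q, hq, hq'⟩ := p.exists_heightOneSpectrum
      (B := integralClosure (Algebra.adjoin k {x}) F) (fun b => (hBT b).1)
    intro y hy
    rw [hq] at hy
    obtain ⟨a, s, has⟩ := q.exists_primeCompl_mul_eq_of_integer y hy
    have hs1 : p.valuation ((s : integralClosure (Algebra.adjoin k {x}) F) : F) = 1 := by
      refine le_antisymm ((p.valuation_le_one_iff _).2 (hBT _).1) (not_lt.1 fun hlt => ?_)
      exact s.2 ((hq' _).2 hlt)
    have hs0 : ((s : integralClosure (Algebra.adjoin k {x}) F) : F) ≠ 0 := by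
      intro h0; rw [h0] at hs1; simp at hs1
    have hsinv : ((s : integralClosure (Algebra.adjoin k {x}) F) : F)⁻¹ ∈ p.ring := by
      rw [← p.valuation_le_one_iff, map_inv₀, hs1, inv_one]
    have hy' : y = (a : F) / ((s : integralClosure (Algebra.adjoin k {x}) F) : F) := by
      rw [eq_div_iff hs0]; exact has
    obtain ⟨haR, u, hu, hau⟩ := hBT a
    obtain ⟨hsR, v, hv, hsv⟩ := hBT s
    refine ⟨((s : integralClosure (Algebra.adjoin k {x}) F) : F)⁻¹ ^ 2 *
      ((s : integralClosure (Algebra.adjoin k {x}) F) * u - a * v),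
      mul_mem (pow_mem hsinv 2) (sub_mem (mul_mem hsR hu) (mul_mem haR hv)), ?_⟩
    rw [hy', Derivation.leibniz_div, hau, hsv, smul_smul, smul_smul, ← sub_smul, smul_smul]
  obtain ⟨u, hu1, hu⟩ := uniformizer_differential p hxp hx0 hgood (ht p)
  have hu0 : u ≠ 0 := by rintro rfl; simp at hu1
  have hh1 : p.valuation h = 1 := by
    refine le_antisymm ((p.valuation_le_one_iff _).2 hhp) ?_
    have := (p.valuation_le_one_iff _).2 hhp'
    rw [map_inv₀] at this
    exact (inv_le_one₀ (zero_lt_iff.2 ((_root_.map_ne_zero _).2 hh0))).1 this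
  refine ⟨h * u⁻¹, by rw [map_mul, map_inv₀, hh1, hu1]; simp, ?_⟩
  rw [hu, smul_smul, mul_assoc, inv_mul_cancel₀ hu0, mul_one]

theorem exists_smul_eq [PerfectField k] [IsFunctionField k F] (ω η : Ω[F⁄k]) (hη : η ≠ 0) :
    ∃ f : F, ω = f • η := by
  obtain ⟨x, -, hsep, -⟩ := exists_separating (k := k) (F := F)
  obtain ⟨a, rfl⟩ := exists_smul_D (k := k) x ω
  obtain ⟨b, rfl⟩ := exists_smul_D (k := k) x η
  have hb : b ≠ 0 := by rintro rfl; simp at hη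
  exact ⟨a * b⁻¹, by rw [smul_smul, mul_assoc, inv_mul_cancel₀ hb, mul_one]⟩

end Places

section Differentials

variable {k F : Type*} [Field k] [Field F] [Algebra k F]

open Classical in
/-- The quotient `ω / η` in `F` of two rational differentials, `η ≠ 0`. -/
noncomputable def quotient (ω η : Ω[F⁄k]) : F :=
  if h : ∃ f : F, ω = f • η then h.choose else 0

theorem quotient_smul [PerfectField k] [IsFunctionField k F] (ω η : Ω[F⁄k]) (hη : η ≠ 0) :
    quotient ω η • η = ω := by
  have h := exists_smul_eq ω η hη
  rw [quotient, dif_pos h]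
  exact h.choose_spec.symm

theorem quotient_eq {ω η : Ω[F⁄k]} (hη : η ≠ 0) {f : F} (h : ω = f • η) : quotient ω η = f := by
  have h' : ∃ f : F, ω = f • η := ⟨f, h⟩
  rw [quotient, dif_pos h']
  exact smul_left_injective F hη (h'.choose_spec.symm.trans h)

variable (k F) in
/-- A choice of a local parameter `π_p` at every closed point `p`. -/
structure LocalParameters where
  /-- the local parameter at a point -/
  toFun : Place k F → F
  isUniformizer : ∀ p : Place k F, p.valuation (toFun p) = WithZero.exp (-1)

instance : CoeFun (LocalParameters k F) (fun _ => Place k F → F) := ⟨LocalParameters.toFun⟩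

/-- The coefficient `h` in `ω = h dπ_p`. -/
noncomputable def coefficient (π : LocalParameters k F) (p : Place k F) (ω : Ω[F⁄k]) : F :=
  quotient ω (KaehlerDifferential.D k F (π p))

/-- The order `ord_p ω` of a non-zero rational differential: `ord_p h`, where `ω = h dπ_p`. -/
noncomputable def differentialOrd (π : LocalParameters k F) (p : Place k F) (ω : Ω[F⁄k]) : ℤ :=
  p.ord (coefficient π p ω)

open Classical in
/-- The residue `res_p ω` at a point `p` of degree one: write `ω = h dπ_p`, and take the coefficient
of `π_p⁻¹` in the Laurent expansion of `h` in `π_p`, whose polar part is a polynomial in `π_p⁻¹`. -/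
noncomputable def residue (π : LocalParameters k F) (p : Place k F) (ω : Ω[F⁄k]) : k :=
  if H : ∃ Q : k[X], coefficient π p ω - aeval (π p)⁻¹ Q ∈ p.ring then H.choose.coeff 1 else 0

/-- The local component `ω_p : a ↦ res_p (a ω)` of a rational differential at a point `p` of degree
one, restricted to `F`. -/
noncomputable def localComponent (π : LocalParameters k F) (p : Place k F) (ω : Ω[F⁄k])
    (a : F) : k :=
  residue π p (a • ω)

variable (k F) in
/-- Divisors on the curve. -/
abbrev Divisor := Place k F →₀ ℤ

theorem differentialOrd_support_finite [PerfectField k] [IsFunctionField k F]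
    (π : LocalParameters k F) (ω : Ω[F⁄k]) (hω : ω ≠ 0) :
    (Function.support fun p => differentialOrd π p ω).Finite := by
  refine (finite_differential_support π π.isUniformizer ω hω).subset ?_
  rintro p hp ⟨f, hf, hωf⟩
  have hD : KaehlerDifferential.D k F (π p) ≠ 0 := by
    intro h0
    rw [h0, smul_zero] at hωf
    exact hω hωf
  apply hp
  change p.ord (quotient ω _) = 0
  rw [quotient_eq hD hωf, Place.ord, hf]
  simp

/-- The divisor `(ω) = ∑ ord_p(ω) p` of a non-zero rational differential `ω`. -/
noncomputable def canonicalDivisor [PerfectField k] [IsFunctionField k F]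
    (π : LocalParameters k F) (ω : Ω[F⁄k]) (hω : ω ≠ 0) : Divisor k F :=
  Finsupp.ofSupportFinite (fun p => differentialOrd π p ω)
    (differentialOrd_support_finite π ω hω)

/-- The divisor `D = p₁ + ⋯ + p_n`. -/
noncomputable def pointDivisor {n : ℕ} (P : Fin n → Place k F) : Divisor k F :=
  ∑ i, Finsupp.single (P i) 1

/-- `ω₀` is `D`-special, `D = p₁ + ⋯ + p_n`. -/
def IsSpecial (π : LocalParameters k F) {n : ℕ} (P : Fin n → Place k F) (ω₀ : Ω[F⁄k]) : Prop :=
  ω₀ ≠ 0 ∧ ∀ i, differentialOrd π (P i) ω₀ = -1 ∧ residue π (P i) ω₀ = 1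

end Differentials

section Adeles

open scoped RestrictedProduct

/-- The adele ring `𝔸` of `F / k`: the restricted product of all the local fields `F_p` with
respect to the `O_p`. -/
abbrev Adele (k F : Type*) [Field k] [Field F] [Algebra k F] : Type _ :=
  Πʳ p : Place k F, [p.Completion, p.integers]

variable {k F : Type*} [Field k] [Field F] [Algebra k F]

/-- The diagonal embedding of `F` in `𝔸`. -/
noncomputable def diagonal [PerfectField k] [IsFunctionField k F] : F →+* Adele k F where
  toFun f := ⟨fun p => (f : p.Completion), by
    refine (finite_poles (k := k) f).subset ?_
    intro p hp hf
    apply hp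
    change (f : p.Completion) ∈ p.spec.adicCompletionIntegers F
    rw [HeightOneSpectrum.mem_adicCompletionIntegers,
      HeightOneSpectrum.valuedAdicCompletion_eq_valuation']
    exact (p.valuation_le_one_iff f).2 hf⟩
  map_one' := Subtype.ext <| funext fun _ => HeightOneSpectrum.adicCompletion.coe_one ..
  map_mul' _ _ := Subtype.ext <| funext fun _ => HeightOneSpectrum.adicCompletion.coe_mul ..
  map_zero' := Subtype.ext <| funext fun _ => HeightOneSpectrum.adicCompletion.coe_zero ..
  map_add' _ _ := Subtype.ext <| funext fun _ => HeightOneSpectrum.adicCompletion.coe_add ..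

variable (k F) in
/-- `O^r`, where `O = {a ∈ 𝔸 : a_p ∈ O_p for all p}`. -/
def integralVectors (r : ℕ) : Set (Fin r → Adele k F) :=
  {a | ∀ j, ∀ p : Place k F, a j p ∈ p.integers}

theorem localParameter_ne_zero (π : LocalParameters k F) (p : Place k F) :
    ((π p : F) : p.Completion) ≠ 0 := by
  intro h
  have h1 := HeightOneSpectrum.valuedAdicCompletion_eq_valuation' p.spec (π p)
  rw [h, map_zero] at h1
  exact WithZero.exp_ne_zero ((π.isUniformizer p).symm.trans h1.symm)

/-- The characterizing idele `ι_E = (π_p ^ ord_p(E))_p` of a divisor `E`. -/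
noncomputable def idele (π : LocalParameters k F) (E : Divisor k F) : (Adele k F)ˣ :=
  RestrictedProduct.mkUnit (fun p => Units.mk0 _ (localParameter_ne_zero π p) ^ E p) (by
    refine E.support.finite_toSet.subset fun p hp => Finsupp.mem_support_iff.2 fun hE => hp ?_
    change Units.mk0 _ (localParameter_ne_zero π p) ^ E p ∈ (Submonoid.ofClass p.integers).units
    rw [hE, zpow_zero]
    exact one_mem _)

/-- The component `g_p` in `GL_r(F_p)` of `g` in `GL_r(𝔸)`. -/
noncomputable def component {r : ℕ} (p : Place k F) :
    GL (Fin r) (Adele k F) →* GL (Fin r) p.Completion :=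
  Matrix.GeneralLinearGroup.map
    (RestrictedProduct.evalRingHom (fun p : Place k F => p.Completion) p)

/-- `m₁ ≤ ⋯ ≤ m_r` are the `p`-multiple orders of `g`: `M g_p N = diag(π_p ^ m_j)` for some
`M, N` in `GL_r(O_p)`. -/
def IsMultipleOrders (π : LocalParameters k F) {r : ℕ} (p : Place k F)
    (g : GL (Fin r) (Adele k F)) (m : Fin r → ℤ) : Prop :=
  Monotone m ∧ ∃ M N : GL (Fin r) p.integers,
    ((Matrix.GeneralLinearGroup.map p.integers.subtype M * component p g *
      Matrix.GeneralLinearGroup.map p.integers.subtype N : GL (Fin r) p.Completion) :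
        Matrix (Fin r) (Fin r) p.Completion) =
      Matrix.diagonal fun j => ((π p : F) : p.Completion) ^ m j

/-- `g` is `D`-balanced, `D = p₁ + ⋯ + p_n`: all its `p_i`-multiple orders vanish. -/
def IsBalanced (π : LocalParameters k F) {n r : ℕ} (P : Fin n → Place k F)
    (g : GL (Fin r) (Adele k F)) : Prop :=
  ∀ i, IsMultipleOrders π (P i) g fun _ => 0

/-- `𝔸^r(g) = {a ∈ 𝔸^r : g a ∈ O^r}`. -/
def adelicSpace {r : ℕ} (g : GL (Fin r) (Adele k F)) : Set (Fin r → Adele k F) :=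
  {a | (g : Matrix (Fin r) (Fin r) (Adele k F)).mulVec a ∈ integralVectors k F r}

/-- `g O^r`, a subset of `𝔸^r`. -/
def imageLattice {r : ℕ} (g : GL (Fin r) (Adele k F)) : Set (Fin r → Adele k F) :=
  (g : Matrix (Fin r) (Fin r) (Adele k F)).mulVec '' integralVectors k F r

/-- `E`-twist `ι_E g`. -/
noncomputable def twist (π : LocalParameters k F) {r : ℕ} (E : Divisor k F)
    (g : GL (Fin r) (Adele k F)) : GL (Fin r) (Adele k F) :=
  Matrix.GeneralLinearGroup.scalar (Fin r) (idele π E) * g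

variable [PerfectField k] [IsFunctionField k F]

/-- `H⁰(F, g) = 𝔸^r(g) ∩ F^r`. -/
def H0 {r : ℕ} (g : GL (Fin r) (Adele k F)) : Set (Fin r → F) :=
  {f | (fun j => diagonal (k := k) (f j)) ∈ adelicSpace g}

/-- The rank `r` algebraic geometry code
`C_{F,r}(D, g) = {((f_j(p₁))_j, …, (f_j(p_n))_j) : (f_j) ∈ H⁰(F, g)}`. -/
def codeF {n r : ℕ} (P : Fin n → Place k F) (g : GL (Fin r) (Adele k F)) :
    Set (Fin n → Fin r → k) :=
  (fun f i j => (P i).value (f j)) '' H0 g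

/-- The space `Ω_F^r(g(-D))` of the `(ω_j) ∈ Ω_F^r` with `ι_{(ω₀)+D} (ω_j / ω₀)_j ∈ g O^r`. -/
def differentialSpace (π : LocalParameters k F) (ω₀ : Ω[F⁄k]) (hω₀ : ω₀ ≠ 0) {n r : ℕ}
    (P : Fin n → Place k F) (g : GL (Fin r) (Adele k F)) : Set (Fin r → Ω[F⁄k]) :=
  {ω | (fun j => (idele π (canonicalDivisor π ω₀ hω₀ + pointDivisor P) : Adele k F) *
      diagonal (quotient (ω j) ω₀)) ∈ imageLattice g}

/-- The rank `r` differential code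
`C_{Ω,r}(D, g) = {((ω_{j,p₁}(1))_j, …, (ω_{j,p_n}(1))_j) : (ω_j) ∈ Ω_F^r(g(-D))}`. -/
def codeOmega (π : LocalParameters k F) (ω₀ : Ω[F⁄k]) (hω₀ : ω₀ ≠ 0) {n r : ℕ}
    (P : Fin n → Place k F) (g : GL (Fin r) (Adele k F)) : Set (Fin n → Fin r → k) :=
  (fun ω i j => localComponent π (P i) (ω j) 1) '' differentialSpace π ω₀ hω₀ P g

end Adeles

end AdelicCode

namespace AdelicCode

/-! ### Residues at points of degree one -/

section Residues

variable {k F : Type*} [Field k] [Field F] [Algebra k F]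

/-! The space of rational differentials is one-dimensional over `F`, so division by `ω₀` turns
`(ω_j)` into functions `f_j = ω_j / ω₀`. Put `ι = ι_{(ω₀)+D}`. As `ι` is scalar and `g` is
invertible, `ι f ∈ g O^r` says the same as `(ι g⁻¹) f ∈ O^r`. Division by `ω₀` is therefore a
bijection from the differential space of `g` to `H⁰(F, ι g⁻¹)` (`mem_differentialSpace_iff`).

It remains to compare coordinates: `res_{p_i}(f_j ω₀)` on one side, `f_j(p_i)` on the other. The
divisor `(ω₀) + D` has coefficient `-1 + 1 = 0` at `p_i`, so `ι` has component `1` there. Being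
balanced means having components in the groups `GL_r(O_{p_i})`, hence passes from `g` to `ι g⁻¹`
(`IsBalanced.twist_inv`) and forces the `f_j` to be regular at `p_i` (`mem_ring_of_mem_H0`). At a
simple pole with residue `1` this gives `res(f ω₀) = f(p)` (`residue_smul`), because the zero of `f
- f(p)` cancels the pole. The argument is local at each `p_i`; the residue theorem and Riemann–Roch
play no role. -/

theorem Place.algebraMap_residueField_surjective (p : Place k F) (hp : p.degree = 1) :
    Function.Surjective (algebraMap k (IsLocalRing.ResidueField p.ring)) := by
  intro y
  obtain ⟨c, hc⟩ := (finrank_eq_one_iff_of_nonzero' (1 : IsLocalRing.ResidueField p.ring)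
    one_ne_zero).1 hp y
  exact ⟨c, by rw [← hc, Algebra.smul_def, mul_one]⟩

/-- A function regular at a point of degree one agrees there with its value, to first order. -/
theorem Place.valuation_sub_value_lt_one (p : Place k F) (hp : p.degree = 1) {f : F}
    (hf : f ∈ p.ring) : p.valuation (f - algebraMap k F (p.value f)) < 1 := by
  have h : algebraMap k (IsLocalRing.ResidueField p.ring) (p.value f) =
      IsLocalRing.residue p.ring ⟨f, hf⟩ := by
    rw [Place.value, dif_pos hf]
    -- `Function.invFun` inverts only on the range; degree one makes every residue class the class
    -- of a constant.
    exact Function.invFun_eq (p.algebraMap_residueField_surjective hp _)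
  have h2 : IsLocalRing.residue p.ring (⟨f, hf⟩ - algebraMap k p.ring (p.value f)) = 0 := by
    rw [map_sub, ← h]
    exact sub_self _
  rw [IsLocalRing.residue_eq_zero_iff] at h2
  exact (p.spec.valuation_lt_one_iff_mem (K := F) _).2 h2

/-- Both `c` and `c⁻¹` lie in the local ring, so neither has valuation above `1`. -/
theorem Place.valuation_algebraMap (p : Place k F) {c : k} (hc : c ≠ 0) :
    p.valuation (algebraMap k F c) = 1 := by
  refine le_antisymm ((p.valuation_le_one_iff _).2 (p.algebraMap_mem c)) ?_
  have h := (p.valuation_le_one_iff _).2 (p.algebraMap_mem c⁻¹)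
  rw [map_inv₀, map_inv₀] at h
  exact (inv_le_one₀ (zero_lt_iff.2 ((_root_.map_ne_zero _).2
    ((_root_.map_ne_zero _).2 hc)))).1 h

/-- A polynomial in the inverse of a local parameter that is regular at the point is constant. -/
theorem natDegree_eq_zero_of_aeval_inv_mem (p : Place k F) {t : F}
    (ht : p.valuation t = WithZero.exp (-1)) {Q : k[X]} (hQ : aeval t⁻¹ Q ∈ p.ring) :
    Q.natDegree = 0 := by
  by_contra hd
  have hQ0 : Q ≠ 0 := by rintro rfl; simp at hd
  have ht' : p.valuation t⁻¹ = WithZero.exp 1 := by rw [map_inv₀, ht, ← WithZero.exp_neg]; simp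
  have hpow : ∀ i : ℕ, p.valuation (t⁻¹ ^ i) = WithZero.exp (i : ℤ) := by
    intro i
    rw [map_pow, ht', ← WithZero.exp_nsmul]; simp
  -- Distinct powers of `t⁻¹` have distinct valuations, so the leading term dominates and fixes the
  -- valuation of the whole sum, which exceeds `1` in positive degree.
  have hlow : p.valuation (aeval t⁻¹ Q.eraseLead) < WithZero.exp (Q.natDegree : ℤ) := by
    rw [aeval_eq_sum_range]
    refine Valuation.map_sum_lt _ WithZero.exp_ne_zero fun i hi => ?_
    have hi' : i < Q.natDegree := by
      have h1 := Finset.mem_range.1 hi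
      -- The bound is `natDegree - 1`, a true subtraction because `hd` excludes degree `0`.
      have h2 := eraseLead_natDegree_le Q
      omega
    rw [Algebra.smul_def, map_mul, hpow]
    refine (mul_le_of_le_one_left' ((p.valuation_le_one_iff _).2
      (p.algebraMap_mem _))).trans_lt ?_
    rw [WithZero.exp_lt_exp]
    exact_mod_cast hi'
  have hlead : p.valuation (aeval t⁻¹ (monomial Q.natDegree Q.leadingCoeff)) =
      WithZero.exp (Q.natDegree : ℤ) := by
    rw [aeval_monomial, map_mul, hpow, p.valuation_algebraMap (leadingCoeff_ne_zero.2 hQ0),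
      one_mul]
  have hv : p.valuation (aeval t⁻¹ Q) = WithZero.exp (Q.natDegree : ℤ) := by
    rw [← hlead, ← Valuation.map_add_eq_of_lt_left p.valuation (hlow.trans_eq hlead.symm),
      ← map_add, add_comm, eraseLead_add_monomial_natDegree_leadingCoeff]
  have h := (p.valuation_le_one_iff _).2 hQ
  rw [hv, ← WithZero.exp_zero, WithZero.exp_le_exp] at h
  exact hd (by exact_mod_cast le_antisymm h (by positivity))

/-- The polynomial chosen in `residue` does not matter: two candidates differ by a polynomial in
`π_p⁻¹` regular at `p`, hence by a constant, which leaves `coeff 1` unchanged. -/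
theorem residue_eq (π : LocalParameters k F) (p : Place k F) {ω : Ω[F⁄k]} {Q : k[X]}
    (hQ : coefficient π p ω - aeval (π p)⁻¹ Q ∈ p.ring) : residue π p ω = Q.coeff 1 := by
  have H : ∃ Q : k[X], coefficient π p ω - aeval (π p)⁻¹ Q ∈ p.ring := ⟨Q, hQ⟩
  rw [residue, dif_pos H, ← sub_eq_zero, ← coeff_sub]
  refine coeff_eq_zero_of_natDegree_lt ?_
  rw [natDegree_eq_zero_of_aeval_inv_mem p (π.isUniformizer p)]
  · exact one_pos
  · have h := sub_mem hQ H.choose_spec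
    rw [map_sub]
    convert h using 1
    ring

/-- At a simple pole of `ω` of degree one, `res_p (f ω) = f(p) res_p ω`. -/
theorem residue_smul (π : LocalParameters k F) (p : Place k F) (hp : p.degree = 1)
    {ω : Ω[F⁄k]} (hω : ω ≠ 0) (hord : differentialOrd π p ω = -1)
    (hres : residue π p ω ≠ 0) {f : F} (hf : f ∈ p.ring) :
    residue π p (f • ω) = p.value f * residue π p ω := by
  -- Without an expansion `residue` would take its default value `0`, contrary to `hres`.
  have hH : ∃ Q : k[X], coefficient π p ω - aeval (π p)⁻¹ Q ∈ p.ring := by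
    by_contra h
    exact hres (dif_neg h)
  obtain ⟨Q, hQ⟩ := hH
  have hv : p.valuation (coefficient π p ω) = WithZero.exp 1 := by
    have hlog : WithZero.log (p.valuation (coefficient π p ω)) = 1 := by
      have : -WithZero.log (p.valuation (coefficient π p ω)) = -1 := hord
      omega
    -- Since `log 0 = 0`, order `-1` rules out a zero coefficient.
    have h0 : p.valuation (coefficient π p ω) ≠ 0 := by
      intro h0
      rw [h0, WithZero.log_zero] at hlog
      omega
    rw [← WithZero.exp_log h0, hlog]
  have hex : ∃ h : F, ω = h • KaehlerDifferential.D k F (π p) := by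
    by_contra hex
    have h0 : coefficient π p ω = 0 := dif_neg hex
    rw [h0, map_zero] at hv
    exact WithZero.exp_ne_zero hv.symm
  obtain ⟨h, hh⟩ := hex
  have hD : KaehlerDifferential.D k F (π p) ≠ 0 := by
    intro h0
    rw [h0, smul_zero] at hh
    exact hω hh
  have hc : coefficient π p ω = h := quotient_eq hD hh
  have hcf : coefficient π p (f • ω) = f * h := quotient_eq hD (by rw [hh, smul_smul])
  rw [residue_eq π p hQ, ← coeff_C_mul]
  refine residue_eq π p ?_
  rw [hc] at hQ hv
  -- The candidate polar part of `f h` is `f(p) Q`. The error is a constant times a regular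
  -- function, plus `(f - f(p)) h`, where a zero meets a simple pole.
  have hsplit : f * h - aeval (π p)⁻¹ (C (p.value f) * Q) =
      algebraMap k F (p.value f) * (h - aeval (π p)⁻¹ Q) +
        (f - algebraMap k F (p.value f)) * h := by
    rw [map_mul, aeval_C]
    ring
  rw [hcf, hsplit]
  refine add_mem (mul_mem (p.algebraMap_mem _) hQ) ?_
  rw [← p.valuation_le_one_iff, map_mul, hv]
  have hlt := p.valuation_sub_value_lt_one hp hf
  rcases eq_or_ne (p.valuation (f - algebraMap k F (p.value f))) 0 with h0 | h0
  · rw [h0, zero_mul]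
    exact zero_le
  -- Valuations are discrete: a negative logarithm is at most `-1`, which offsets the `1` coming
  -- from `h`.
  · have h3 : WithZero.log (p.valuation (f - algebraMap k F (p.value f))) < 0 :=
      (WithZero.log_lt_iff_lt_exp h0).2 (by simpa using hlt)
    rw [← WithZero.exp_log h0, ← WithZero.exp_add, ← WithZero.exp_zero, WithZero.exp_le_exp]
    omega

/-- Distinctness of the points keeps each multiplicity at `1`; this is what cancels the simple pole
of `ω₀`. -/
theorem pointDivisor_apply {n : ℕ} {P : Fin n → Place k F} (hP : Function.Injective P)
    (i : Fin n) : pointDivisor P (P i) = 1 := by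
  classical
  rw [pointDivisor, Finsupp.finsetSum_apply]
  simp [Finsupp.single_apply, hP.eq_iff]

end Residues

/-! ### Balanced elements, twists and lattices -/

section Adeles

variable {k F : Type*} [Field k] [Field F] [Algebra k F]

theorem idele_apply_eq_one (π : LocalParameters k F) {E : Divisor k F} {p : Place k F}
    (hE : E p = 0) : (idele π E : Adele k F) p = 1 := by
  change ((Units.mk0 _ (localParameter_ne_zero π p) ^ E p : (p.Completion)ˣ) :
    p.Completion) = 1
  rw [hE, zpow_zero, Units.val_one]

/-- At `p` the twist multiplies by the scalar `π_p ^ E(p)`, which is trivial off the support of `E`.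
-/
theorem component_twist (π : LocalParameters k F) {r : ℕ} {E : Divisor k F} {p : Place k F}
    (hE : E p = 0) (g : GL (Fin r) (Adele k F)) :
    component p (twist π E g) = component p g := by
  have h : component p (Matrix.GeneralLinearGroup.scalar (Fin r) (idele π E)) = 1 := by
    refine Units.ext (Matrix.ext fun i j => ?_)
    change ((Matrix.scalar (Fin r) (idele π E : Adele k F)) i j) p = (1 : Matrix _ _ _) i j
    rw [Matrix.scalar_apply, Matrix.diagonal_apply, Matrix.one_apply]
    split_ifs
    · exact idele_apply_eq_one π hE
    · rfl
  rw [twist, map_mul, h, one_mul]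

/-- The `p`-multiple orders of `g` vanish if and only if `g_p` is in `GL_r(O_p)`. -/
theorem isMultipleOrders_zero_iff (π : LocalParameters k F) {r : ℕ} (p : Place k F)
    (g : GL (Fin r) (Adele k F)) :
    IsMultipleOrders π p g (fun _ => 0) ↔
      ∃ U : GL (Fin r) p.integers,
        component p g = Matrix.GeneralLinearGroup.map p.integers.subtype U := by
  constructor
  · rintro ⟨-, M, N, h⟩
    -- With zero orders the diagonal matrix is `1`, so `g_p = M⁻¹ N⁻¹`.
    have h1 : Matrix.GeneralLinearGroup.map p.integers.subtype M * component p g *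
        Matrix.GeneralLinearGroup.map p.integers.subtype N = 1 := by
      apply Units.ext
      rw [h]
      simp
    refine ⟨M⁻¹ * N⁻¹, ?_⟩
    rw [map_mul, map_inv, map_inv, eq_mul_inv_iff_mul_eq]
    exact eq_inv_of_mul_eq_one_right (by rwa [← mul_assoc])
  · rintro ⟨U, hU⟩
    refine ⟨monotone_const, U⁻¹, 1, ?_⟩
    rw [hU, map_one, mul_one, map_inv, inv_mul_cancel]
    simp

/-- The matrices in `GL_r(O_p)` form a group, and the twist is invisible at the points of `D`. -/
theorem IsBalanced.twist_inv (π : LocalParameters k F) {n r : ℕ} {P : Fin n → Place k F}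
    {E : Divisor k F} (hE : ∀ i, E (P i) = 0) {g : GL (Fin r) (Adele k F)}
    (hg : IsBalanced π P g) : IsBalanced π P (twist π E g⁻¹) := by
  intro i
  obtain ⟨U, hU⟩ := (isMultipleOrders_zero_iff π (P i) g).1 (hg i)
  refine (isMultipleOrders_zero_iff π (P i) _).2 ⟨U⁻¹, ?_⟩
  rw [component_twist π (hE i), map_inv, map_inv, hU]

/-- Converts the image condition defining the differential space into the preimage condition
defining `H0`. -/
theorem mem_imageLattice_iff {r : ℕ} (g : GL (Fin r) (Adele k F)) (a : Fin r → Adele k F) :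
    a ∈ imageLattice g ↔
      ((g⁻¹ : GL (Fin r) (Adele k F)) : Matrix (Fin r) (Fin r) (Adele k F)).mulVec a ∈
        integralVectors k F r := by
  constructor
  · rintro ⟨b, hb, rfl⟩
    rw [Matrix.mulVec_mulVec, ← Units.val_mul, inv_mul_cancel, Units.val_one, Matrix.one_mulVec]
    exact hb
  · intro h
    refine ⟨_, h, ?_⟩
    rw [Matrix.mulVec_mulVec, ← Units.val_mul, mul_inv_cancel, Units.val_one, Matrix.one_mulVec]

/-- A scalar idele commutes with `g`, so it can be moved from the matrix onto the vector. -/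
theorem twist_mulVec (π : LocalParameters k F) {r : ℕ} (E : Divisor k F)
    (g : GL (Fin r) (Adele k F)) (a : Fin r → Adele k F) :
    (twist π E g : Matrix (Fin r) (Fin r) (Adele k F)).mulVec a =
      (g : Matrix (Fin r) (Fin r) (Adele k F)).mulVec fun j => (idele π E : Adele k F) * a j := by
  have h : (twist π E g : Matrix (Fin r) (Fin r) (Adele k F)) =
      (idele π E : Adele k F) • (g : Matrix (Fin r) (Fin r) (Adele k F)) := by
    change Matrix.scalar (Fin r) (idele π E : Adele k F) * _ = _
    rw [Matrix.scalar_apply, ← Matrix.smul_eq_diagonal_mul]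
  rw [h, Matrix.smul_mulVec, ← Matrix.mulVec_smul]
  rfl

/-! ### Global sections and regularity -/

variable [PerfectField k] [IsFunctionField k F]

/-- Recover `f` as `g⁻¹ (g f)`: at `p` both the matrix `g⁻¹` and the vector `g f` are integral. This
ensures that `value` is evaluated on regular functions, not at its default. -/
theorem mem_ring_of_mem_H0 (π : LocalParameters k F) {r : ℕ} {p : Place k F}
    {g : GL (Fin r) (Adele k F)} (hg : IsMultipleOrders π p g fun _ => 0) {f : Fin r → F}
    (hf : f ∈ H0 g) (j : Fin r) : f j ∈ p.ring := by
  obtain ⟨U, hU⟩ := (isMultipleOrders_zero_iff π p g).1 hg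
  let a : Fin r → Adele k F := fun j => diagonal (k := k) (f j)
  let b := (g : Matrix (Fin r) (Fin r) (Adele k F)).mulVec a
  have hb : b ∈ integralVectors k F r := hf
  have hba : ((g⁻¹ : GL (Fin r) (Adele k F)) : Matrix (Fin r) (Fin r) (Adele k F)).mulVec b =
      a := by
    rw [Matrix.mulVec_mulVec, ← Units.val_mul, inv_mul_cancel, Units.val_one, Matrix.one_mulVec]
  have hent : ∀ l, ((g⁻¹ : GL (Fin r) (Adele k F)) j l) p ∈ p.integers := by
    intro l
    have h1 : component p g⁻¹ = Matrix.GeneralLinearGroup.map p.integers.subtype U⁻¹ := by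
      rw [map_inv, hU, map_inv]
    have h2 := congrArg (fun A : GL (Fin r) p.Completion => A j l) h1
    change ((g⁻¹ : GL (Fin r) (Adele k F)) j l) p =
      ((U⁻¹ : GL (Fin r) p.integers) j l : p.Completion) at h2
    rw [h2]
    exact Subtype.property _
  have hsum : a j p = ∑ l, ((g⁻¹ : GL (Fin r) (Adele k F)) j l) p * b l p := by
    rw [← hba]
    exact map_sum (RestrictedProduct.evalRingHom (fun p : Place k F => p.Completion) p) _ _
  have hmem : a j p ∈ p.integers := by
    rw [hsum]
    exact sum_mem fun l _ => mul_mem (hent l) (hb l p)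
  -- The valuation of the completion restricts to that of `F`, so integrality descends to the local
  -- ring.
  change ((f j : F) : p.Completion) ∈ p.spec.adicCompletionIntegers F at hmem
  rw [HeightOneSpectrum.mem_adicCompletionIntegers,
    HeightOneSpectrum.valuedAdicCompletion_eq_valuation'] at hmem
  exact (p.valuation_le_one_iff _).1 hmem

/-- Division by `ω₀` identifies `Ω_F^r(g(-D))` with `H⁰(F, ι_{(ω₀)+D} g⁻¹)`. -/
theorem mem_differentialSpace_iff (π : LocalParameters k F) (ω₀ : Ω[F⁄k]) (hω₀ : ω₀ ≠ 0)
    {n r : ℕ} (P : Fin n → Place k F) (g : GL (Fin r) (Adele k F)) (ω : Fin r → Ω[F⁄k]) :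
    ω ∈ differentialSpace π ω₀ hω₀ P g ↔ (fun j => quotient (ω j) ω₀) ∈
      H0 (twist π (canonicalDivisor π ω₀ hω₀ + pointDivisor P) g⁻¹) := by
  change _ ∈ imageLattice g ↔ Matrix.mulVec _ _ ∈ integralVectors k F r
  rw [mem_imageLattice_iff, twist_mulVec]

end Adeles

end AdelicCode

/-! ### Comparison of the two codes -/

theorem mainTheorem6 {k F : Type*} [Field k] [Finite k] [Field F] [Algebra k F]
    [AdelicCode.IsFunctionField k F] (π : AdelicCode.LocalParameters k F)
    {n r : ℕ} (hr : 0 < r)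
    (P : Fin n → AdelicCode.Place k F) (hP : Function.Injective P)
    (hdeg : ∀ i, (P i).degree = 1)
    (g : GL (Fin r) (AdelicCode.Adele k F)) (hg : AdelicCode.IsBalanced π P g)
    (ω₀ : Ω[F⁄k]) (hω₀ : AdelicCode.IsSpecial π P ω₀) :
    AdelicCode.IsBalanced π P (AdelicCode.twist π
        (AdelicCode.canonicalDivisor π ω₀ hω₀.1 + AdelicCode.pointDivisor P) g⁻¹) ∧
      AdelicCode.codeOmega π ω₀ hω₀.1 P g =
        AdelicCode.codeF P (AdelicCode.twist π
          (AdelicCode.canonicalDivisor π ω₀ hω₀.1 + AdelicCode.pointDivisor P) g⁻¹) := by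
  have hE : ∀ i, (AdelicCode.canonicalDivisor π ω₀ hω₀.1 + AdelicCode.pointDivisor P) (P i) =
      0 := by
    intro i
    have h : AdelicCode.canonicalDivisor π ω₀ hω₀.1 (P i) = -1 := (hω₀.2 i).1
    rw [Finsupp.add_apply, h, AdelicCode.pointDivisor_apply hP]
    rfl
  have hbal := hg.twist_inv π hE
  refine ⟨hbal, ?_⟩
  -- The factor `1 : F` is the argument in `ω_{j,p_i}(1)`, kept so that the left side matches
  -- `localComponent`.
  have hval : ∀ f ∈ AdelicCode.H0 (AdelicCode.twist π
      (AdelicCode.canonicalDivisor π ω₀ hω₀.1 + AdelicCode.pointDivisor P) g⁻¹),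
      ∀ i j, AdelicCode.residue π (P i) ((1 : F) • f j • ω₀) = (P i).value (f j) := by
    intro f hf i j
    obtain ⟨hord, hres⟩ := hω₀.2 i
    rw [one_smul, AdelicCode.residue_smul π (P i) (hdeg i) hω₀.1 hord
      (by rw [hres]; exact one_ne_zero)
      (AdelicCode.mem_ring_of_mem_H0 π (hbal i) hf j), hres, mul_one]
  apply Set.Subset.antisymm
  · rintro _ ⟨ω, hω, rfl⟩
    have hf := (AdelicCode.mem_differentialSpace_iff π ω₀ hω₀.1 P g ω).1 hω
    refine ⟨_, hf, ?_⟩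
    funext i j
    have h := hval _ hf i j
    rw [AdelicCode.quotient_smul _ _ hω₀.1] at h
    exact h.symm
  · rintro _ ⟨f, hf, rfl⟩
    -- Multiplication by `ω₀` inverts the quotient map.
    refine ⟨fun j => f j • ω₀, ?_, ?_⟩
    · rw [AdelicCode.mem_differentialSpace_iff]
      simpa only [AdelicCode.quotient_eq hω₀.1 rfl] using hf
    · funext i j
      exact hval f hf i j
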